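/- For a positive integer $k$ let $f_k=\prod_{i\ge 1}(1-q^{ki})$, a formal power series in $q$ with integer coefficients, and let the integers $P^\ast(n)$, $n\ge 0$, be defined by $$\sum_{n\ge 0}P^\ast(n)q^n=f_1^4f_5^4.$$ Then, for all $n\ge 0$, $$P^\ast(16n+15)=-64\cdot P^\ast(n).$$ -/

import Mathlib

open scoped PowerSeries PowerSeries.WithPiTopology

noncomputable section

/-- The `q`-Pochhammer symbol `(a; q)_∞ = ∏_{i ≥ 0} (1 - a q^i)` for integral formal power series
`a` and `q`; the infinite product is taken in the topology of coefficientwise convergence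
(with `ℤ` discrete). -/
def qPochhammerInf (a q : ℤ⟦X⟧) : ℤ⟦X⟧ := ∏' i : ℕ, (1 - a * q ^ i)

/-- `f_k = (q^k; q^k)_∞`, as a formal power series in the variable `q = X`. -/
def eulerF (k : ℕ) : ℤ⟦X⟧ := qPochhammerInf (PowerSeries.X ^ k) (PowerSeries.X ^ k)

/-- `P*(n)`, the coefficient of `q^n` in `f_1^4 f_5^4`. -/
def Pstar (n : ℕ) : ℤ := PowerSeries.coeff n (eulerF 1 ^ 4 * eulerF 5 ^ 4)

end

/-- For `k ≥ 1` the infinite product that defines `f_k` does converge. -/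
theorem eulerF_hasProd (k : ℕ) (hk : 1 ≤ k) :
    HasProd (fun i : ℕ => (1 : ℤ⟦X⟧) - PowerSeries.X ^ k * (PowerSeries.X ^ k) ^ i) (eulerF k) := by
  have h : Multipliable
      (fun i : ℕ => (1 : ℤ⟦X⟧) - PowerSeries.X ^ k * (PowerSeries.X ^ k) ^ i) := by
    simp_rw [sub_eq_add_neg]
    apply PowerSeries.WithPiTopology.multipliable_one_add_of_tendsto_order_atTop_nhds_top
    refine ENat.tendsto_nhds_top_iff_natCast_lt.mpr
      (fun n => Filter.eventually_atTop.mpr ⟨n, fun m hm => ?_⟩)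
    rw [PowerSeries.order_neg, ← pow_mul, ← pow_add, PowerSeries.order_X_pow]
    norm_cast
    nlinarith
  exact h.hasProd

/-! Put G = f₁⁴f₅⁴. The heart is the recurrence P*(4n+3) = -4P*(2n+1) - 8P*(n), the Hecke relation
at 2 for the weight 4 form qG(q). Its characteristic polynomial x² + 4x + 8 divides x⁴ + 64, whence
the factor -64 after four doublings of n+1.

The recurrence says that the odd part of G is q·B(q²) with B = -4G - 8qG(q²). Gauss' product f₁² =
f₂φ(-q) and the 2-dissection φ(-q) = φ(q⁴) - 2qψ(q⁸), together with their dilations q → q⁵, exhibit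
B as -4f₁²f₅² times a product of two theta expressions. `theta_product_identity` evaluates that
product as f₁²f₅² + 2qψ(q)²ψ(q⁵)², and f₁ψ = f₂² turns the last term into G(q²). The evaluation
rests on ψ² = φψ(q²), on the dissection of φ², and on f₁f₅ = ψ(q²)φ(q⁵) - qφ(q)ψ(q¹⁰), all proved by
reindexing lattice sums. -/

/-! ### Formal theta series and their reindexing -/

/-- The series `∑ i, s i * q ^ e i`. -/
noncomputable def theta {ι : Type*} (s : ι → ℤ) (e : ι → ℕ) : ℤ⟦X⟧ :=
  ∑' i, PowerSeries.monomial (e i) (s i)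

/-- Each value is attained only finitely often. -/
def FiniteFibers {ι : Type*} (e : ι → ℕ) : Prop := ∀ n, {i | e i = n}.Finite

section Theta

variable {ι κ : Type*} {s s' : ι → ℤ} {e : ι → ℕ} {t : κ → ℤ} {d : κ → ℕ}

theorem FiniteFibers.summable (h : FiniteFibers e) (s : ι → ℤ) :
    Summable fun i => PowerSeries.monomial (e i) (s i) := by
  rw [PowerSeries.WithPiTopology.summable_iff_summable_coeff]
  intro n
  refine summable_of_hasFiniteSupport ((h n).subset fun i hi => ?_)
  by_contra hne
  exact hi (by dsimp only; rw [PowerSeries.coeff_monomial, if_neg (Ne.symm hne)])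

theorem FiniteFibers.hasSum (h : FiniteFibers e) (s : ι → ℤ) :
    HasSum (fun i => PowerSeries.monomial (e i) (s i)) (theta s e) :=
  (h.summable s).hasSum

theorem FiniteFibers.of_le {c : ι → ℕ} (h : FiniteFibers c) (hle : ∀ i, c i ≤ e i) :
    FiniteFibers e := fun n =>
  ((Set.finite_Iic n).biUnion fun m _ => h m).subset fun i hi =>
    Set.mem_biUnion (x := c i) (by simpa using (hle i).trans_eq hi) rfl

theorem FiniteFibers.add (h : FiniteFibers e) (h' : FiniteFibers d) :
    FiniteFibers fun p : ι × κ => e p.1 + d p.2 := fun n =>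
  (((Set.finite_Iic n).biUnion fun m _ => h m).prod
    ((Set.finite_Iic n).biUnion fun m _ => h' m)).subset fun p hp => by
      simp only [Set.mem_ofPred_eq] at hp
      simp only [Set.mem_prod, Set.mem_iUnion, Set.mem_ofPred_eq, Set.mem_Iic]
      exact ⟨⟨_, by omega, rfl⟩, ⟨_, by omega, rfl⟩⟩

theorem FiniteFibers.mul_left (h : FiniteFibers e) {k : ℕ} (hk : k ≠ 0) :
    FiniteFibers fun i => k * e i :=
  h.of_le fun _ => Nat.le_mul_of_pos_left _ (Nat.pos_of_ne_zero hk)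

theorem theta_mul (h : FiniteFibers e) (h' : FiniteFibers d) :
    theta s e * theta t d =
      theta (fun p : ι × κ => s p.1 * t p.2) (fun p => e p.1 + d p.2) := by
  have hm : ∀ p : ι × κ, PowerSeries.monomial (e p.1) (s p.1) * PowerSeries.monomial (d p.2) (t p.2)
      = PowerSeries.monomial (e p.1 + d p.2) (s p.1 * t p.2) := fun p =>
    PowerSeries.monomial_mul_monomial _ _ _ _
  unfold theta
  rw [(h.summable s).tsum_mul_tsum (h'.summable t)]
  · exact tsum_congr hm
  · exact ((h.add h').summable _).congr fun p => (hm p).symm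

theorem theta_add (h : FiniteFibers e) :
    theta (fun i => s i + s' i) e = theta s e + theta s' e := by
  unfold theta
  rw [← (h.summable s).tsum_add (h.summable s')]
  exact tsum_congr fun i => map_add _ _ _

theorem theta_neg (s : ι → ℤ) (e : ι → ℕ) : theta (fun i => -s i) e = -theta s e := by
  unfold theta
  rw [← tsum_neg]
  exact tsum_congr fun i => map_neg _ _

theorem theta_sub (h : FiniteFibers e) :
    theta (fun i => s i - s' i) e = theta s e - theta s' e := by
  simp only [sub_eq_add_neg, theta_add h, theta_neg]

theorem X_pow_mul_theta (h : FiniteFibers e) (k : ℕ) :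
    PowerSeries.X ^ k * theta s e = theta s (fun i => k + e i) := by
  unfold theta
  rw [← (h.summable s).tsum_mul_left]
  exact tsum_congr fun i => by
    rw [PowerSeries.X_pow_eq, PowerSeries.monomial_mul_monomial, one_mul]

/-- Reindexing along an injective map whose range contains the support. -/
theorem theta_eq_of_injective {g : κ → ι} (hg : g.Injective) (hs : ∀ i, s i ≠ 0 → ∃ k, g k = i)
    (hst : ∀ k, s (g k) = t k) (hed : ∀ k, e (g k) = d k) : theta s e = theta t d := by
  unfold theta
  rw [← hg.tsum_eq]
  · exact tsum_congr fun k => by rw [hst, hed]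
  · intro i hi
    exact hs i fun h0 => hi (by simp [h0])

/-- The common engine of the dissections: a lattice is cut by a congruence, and each piece is
parametrized by an injective affine map. -/
theorem theta_split {κ' : Type*} {t' : κ' → ℤ} {d' : κ' → ℕ} (h : FiniteFibers e)
    (P : ι → Prop) {g : κ → ι} {g' : κ' → ι}
    (hg : g.Injective) (hg' : g'.Injective)
    (hP : ∀ i, P i ↔ ∃ k, g k = i) (hP' : ∀ i, ¬ P i ↔ ∃ k, g' k = i)
    (hst : ∀ k, s (g k) = t k) (hst' : ∀ k, s (g' k) = t' k)
    (hed : ∀ k, e (g k) = d k) (hed' : ∀ k, e (g' k) = d' k) :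
    theta s e = theta t d + theta t' d' := by
  classical
  have h1 : theta (fun i => if P i then s i else 0) e = theta t d := by
    refine theta_eq_of_injective hg (fun i hi => (hP i).1 ?_) (fun k => ?_) hed
    · by_contra hn; simp [hn] at hi
    · rw [if_pos ((hP _).2 ⟨k, rfl⟩), hst]
  have h2 : theta (fun i => if P i then 0 else s i) e = theta t' d' := by
    refine theta_eq_of_injective hg' (fun i hi => (hP' i).1 ?_) (fun k => ?_) hed'
    · intro hn; simp [hn] at hi
    · rw [if_neg ((hP' _).2 ⟨k, rfl⟩), hst']
  rw [← h1, ← h2, ← theta_add h]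
  congr 1
  funext i
  split_ifs <;> simp

theorem continuous_expand (k : ℕ) (hk : k ≠ 0) :
    Continuous (PowerSeries.expand k hk : ℤ⟦X⟧ → ℤ⟦X⟧) := by
  rw [continuous_iff_continuousAt]
  intro f
  rw [ContinuousAt, PowerSeries.WithPiTopology.tendsto_iff_coeff_tendsto]
  intro n
  simp only [PowerSeries.coeff_expand]
  split_ifs
  · exact (PowerSeries.WithPiTopology.continuous_coeff ℤ _).continuousAt
  · exact tendsto_const_nhds

theorem expand_theta (h : FiniteFibers e) (k : ℕ) (hk : k ≠ 0) :
    PowerSeries.expand k hk (theta s e) = theta s (fun i => k * e i) := by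
  refine ((h.hasSum s).map (PowerSeries.expand k hk) (continuous_expand k hk)).unique ?_
  have := (h.mul_left hk).hasSum s
  simpa [Function.comp_def] using this

end Theta

theorem expand_eulerF (k : ℕ) (hk : k ≠ 0) (m : ℕ) (hm : m ≠ 0) :
    PowerSeries.expand k hk (eulerF m) = eulerF (k * m) := by
  refine ((eulerF_hasProd m (Nat.pos_of_ne_zero hm)).map (PowerSeries.expand k hk)
    (continuous_expand k hk)).unique ?_
  have := eulerF_hasProd (k * m) (Nat.pos_of_ne_zero (mul_ne_zero hk hm))
  simpa [Function.comp_def, pow_mul] using this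

/-! ### The theta functions φ and ψ -/

/-- The exponent of `q` in the square theta series. -/
def sqExp (j : ℤ) : ℕ := (j ^ 2).toNat

/-- The `j`-th triangular number, for an integer `j`. -/
def triExp (j : ℤ) : ℕ := (j * (j + 1) / 2).toNat

@[simp] theorem natCast_sqExp (j : ℤ) : (sqExp j : ℤ) = j ^ 2 := Int.toNat_of_nonneg (sq_nonneg j)

theorem two_mul_triExp (j : ℤ) : 2 * (triExp j : ℤ) = j * (j + 1) := by
  have h : 0 ≤ j * (j + 1) := by
    rcases le_or_gt 0 j with h | h <;> nlinarith
  rw [triExp, Int.toNat_of_nonneg (by omega)]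
  exact Int.mul_ediv_cancel' (Int.even_mul_succ_self j).two_dvd

theorem finiteFibers_of_abs_le {e : ℤ → ℕ} (h : ∀ j, |j| ≤ 2 * e j + 1) : FiniteFibers e := fun n =>
  (Set.finite_Icc (-(2 * n + 1) : ℤ) (2 * n + 1)).subset fun j hj => by
    have := h j
    rw [show e j = n from hj] at this
    exact abs_le.1 this

theorem finiteFibers_sqExp : FiniteFibers sqExp := finiteFibers_of_abs_le fun j => by
  rw [natCast_sqExp, abs_le]; constructor <;> nlinarith [sq_nonneg (j - 1), sq_nonneg (j + 1)]

theorem finiteFibers_triExp : FiniteFibers triExp := finiteFibers_of_abs_le fun j => by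
  rw [two_mul_triExp, abs_le]; constructor <;> nlinarith [sq_nonneg (j - 1), sq_nonneg (j + 1)]

theorem finiteFibers_pentagonal : FiniteFibers pentagonal := fun n =>
  (Set.finite_singleton n).preimage (pentagonal_injective.injOn)

/-- `φ(q) = ∑ q^(j^2)`. -/
noncomputable def phi : ℤ⟦X⟧ := theta (fun _ => 1) sqExp

/-- `φ(-q) = ∑ (-1)^j q^(j^2)`. -/
noncomputable def phiNeg : ℤ⟦X⟧ := theta (fun j => (Int.negOnePow j : ℤ)) sqExp

/-- `ψ(q) = ∑ q^(n(n+1)/2)`, over natural `n`. -/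
noncomputable def psi : ℤ⟦X⟧ := theta (fun _ => 1) (fun n : ℕ => triExp n)

/-- The involution j ↦ -1-j preserves j(j+1)/2 and exchanges the two half-lines. Summing over all of
ℤ makes linear changes of variable available, at the cost of factors of 2 cancelled later. -/
theorem theta_triExp : theta (fun _ => 1) triExp = 2 * psi := by
  rw [two_mul, psi]
  refine theta_split finiteFibers_triExp (fun j => 0 ≤ j) (g := fun n : ℕ => (n : ℤ))
    (g' := fun n : ℕ => -(n + 1 : ℤ)) Nat.cast_injective ?_ ?_ ?_ ?_ ?_ ?_ ?_
  · intro a b h; simpa using h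
  · exact fun i => ⟨fun h => ⟨i.toNat, by simpa using h⟩, by rintro ⟨k, rfl⟩; simp⟩
  · exact fun i => ⟨fun h => ⟨(-i - 1).toNat, by omega⟩,
      by rintro ⟨k, rfl⟩; omega⟩
  · simp
  · simp
  · simp
  · intro k
    have h1 := two_mul_triExp (-(k + 1 : ℤ))
    have h2 := two_mul_triExp k
    have : (triExp (-(k + 1 : ℤ)) : ℤ) = triExp k := by linarith
    exact_mod_cast this

theorem expand_phi (k : ℕ) (hk : k ≠ 0) :
    PowerSeries.expand k hk phi = theta (fun _ => 1) fun j => k * sqExp j :=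
  expand_theta finiteFibers_sqExp k hk

theorem two_mul_expand_psi (k : ℕ) (hk : k ≠ 0) :
    2 * PowerSeries.expand k hk psi = theta (fun _ => 1) fun j => k * triExp j := by
  rw [← expand_theta finiteFibers_triExp k hk, theta_triExp, map_mul, map_ofNat]

theorem eulerF_one_eq_theta :
    eulerF 1 = theta (fun j => (Int.negOnePow j : ℤ)) pentagonal := by
  have h := (eulerF_hasProd 1 le_rfl).tprod_eq
  have h' := PowerSeries.WithPiTopology.tprod_one_sub_X_pow ℤ
  rw [PowerSeries.WithPiTopology.pentagonalSeries_eq_tsum] at h'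
  rw [← h]
  simp only [pow_one, ← pow_succ']
  rw [h', theta]
  refine tsum_congr fun j => ?_
  rw [PowerSeries.monomial_eq_C_mul_X_pow]
  simp

/-- Pairing j = s with j = -(s+1) gives exactly the partial sums of the finite Gauss identity. -/
theorem hasSum_phiNeg :
    HasSum (fun s : ℕ => (-1) ^ s * (PowerSeries.X : ℤ⟦X⟧) ^ s ^ 2 +
      (-1) ^ (s + 1) * PowerSeries.X ^ (s + 1) ^ 2) phiNeg := by
  have h := (finiteFibers_sqExp.hasSum fun j => (Int.negOnePow j : ℤ)).nat_add_neg_add_one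
  rw [phiNeg]
  convert h using 2 with s
  have e1 : sqExp s = s ^ 2 := by zify; simp
  have e2 : sqExp (-(s + 1 : ℤ)) = (s + 1) ^ 2 := by zify; simp; ring
  rw [e1, e2, PowerSeries.monomial_eq_C_mul_X_pow, PowerSeries.monomial_eq_C_mul_X_pow,
    Int.negOnePow_neg]
  simp [Int.negOnePow_succ, pow_succ]

theorem hasSum_psi :
    HasSum (fun s : ℕ => (PowerSeries.X : ℤ⟦X⟧) ^ (s * (s + 1) / 2)) psi := by
  have hf : FiniteFibers fun n : ℕ => triExp n := fun n =>
    (finiteFibers_triExp n).preimage Nat.cast_injective.injOn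
  rw [psi]
  convert hf.hasSum fun _ => 1 using 2 with s
  rw [PowerSeries.X_pow_eq]
  congr 1

/-! ### Gauss' product formulas, from finite identities -/

section Finite

variable {R : Type*} [CommRing R] (x : R)

/-- Finite form of Gauss' identity for `∑ (-1)^j x^(j^2)`. -/
theorem prod_one_add_mul_sum_sq (n : ℕ) :
    (∏ i ∈ Finset.range n, (1 + x ^ (i + 1))) *
      (∑ s ∈ Finset.range (n + 1), ((-1) ^ s * x ^ s ^ 2 + (-1) ^ (s + 1) * x ^ (s + 1) ^ 2)) =
    ∑ s ∈ Finset.range (n + 1), (-1) ^ s * (∏ i ∈ Finset.range s, (1 + x ^ (i + 1))) *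
      (∏ i ∈ Finset.Ico s (n + 1), (1 - x ^ (i + 1))) * x ^ (s * (n + 1)) := by
  induction n with
  | zero => simp [sub_eq_add_neg]
  | succ n ih =>
    -- Passing from n to n+1 changes the truncated sum by the factor 1 + x^(n+1) and one telescoping
    -- remainder. At m = n+1 this remainder and the new summand combine to the two new powers of x.
    have key : ∀ m ≤ n + 1,
        ∑ s ∈ Finset.range m, (-1) ^ s * (∏ i ∈ Finset.range s, (1 + x ^ (i + 1))) *
          (∏ i ∈ Finset.Ico s (n + 2), (1 - x ^ (i + 1))) * x ^ (s * (n + 2)) =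
        (1 + x ^ (n + 1)) *
          ∑ s ∈ Finset.range m, (-1) ^ s * (∏ i ∈ Finset.range s, (1 + x ^ (i + 1))) *
          (∏ i ∈ Finset.Ico s (n + 1), (1 - x ^ (i + 1))) * x ^ (s * (n + 1)) +
        (-1) ^ m * (∏ i ∈ Finset.range m, (1 + x ^ (i + 1))) *
          (∏ i ∈ Finset.Ico m (n + 1), (1 - x ^ (i + 1))) * x ^ (m * (n + 1)) * (1 - x ^ m) := by
      intro m hm
      induction m with
      | zero => simp
      | succ m ihm =>
        rw [Finset.sum_range_succ, ihm (by omega), Finset.sum_range_succ,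
          Finset.prod_range_succ _ m, Finset.prod_Ico_succ_top (by omega : m ≤ n + 1),
          Finset.prod_eq_prod_Ico_succ_bot (by omega : m < n + 1)]
        ring
    rw [Finset.sum_range_succ _ (n + 1), Finset.sum_range_succ _ (n + 1), key _ le_rfl, ← ih,
      mul_add, Finset.prod_range_succ _ n, Finset.Ico_self, Finset.prod_empty,
      Finset.prod_Ico_succ_top le_rfl, Finset.Ico_self, Finset.prod_empty]
    ring

/-- Finite form of Gauss' identity for the generating function of the triangular numbers. -/
theorem prod_one_sub_odd_mul_sum_triangle (n : ℕ) :
    (∏ i ∈ Finset.range n, (1 - x ^ (2 * i + 1))) *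
      (∑ s ∈ Finset.range (2 * n), x ^ (s * (s + 1) / 2)) =
    ∑ s ∈ Finset.range n, (∏ i ∈ Finset.range s, (1 - x ^ (2 * i + 1))) *
      (∏ i ∈ Finset.Ico s n, (1 - x ^ (2 * (i + 1)))) * x ^ (s * (2 * n + 1)) := by
  induction n with
  | zero => simp
  | succ n ih =>
    have key : ∀ m ≤ n,
        ∑ s ∈ Finset.range m, (∏ i ∈ Finset.range s, (1 - x ^ (2 * i + 1))) *
          (∏ i ∈ Finset.Ico s (n + 1), (1 - x ^ (2 * (i + 1)))) * x ^ (s * (2 * (n + 1) + 1)) =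
        (1 - x ^ (2 * n + 1)) *
          ∑ s ∈ Finset.range m, (∏ i ∈ Finset.range s, (1 - x ^ (2 * i + 1))) *
          (∏ i ∈ Finset.Ico s n, (1 - x ^ (2 * (i + 1)))) * x ^ (s * (2 * n + 1)) +
        (∏ i ∈ Finset.range m, (1 - x ^ (2 * i + 1))) *
          (∏ i ∈ Finset.Ico m n, (1 - x ^ (2 * (i + 1)))) * x ^ (m * (2 * n + 1)) *
            (1 - x ^ (2 * m)) := by
      intro m hm
      induction m with
      | zero => simp
      | succ m ihm =>
        rw [Finset.sum_range_succ, ihm (by omega), Finset.sum_range_succ,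
          Finset.prod_range_succ _ m, Finset.prod_Ico_succ_top (by omega : m ≤ n),
          Finset.prod_eq_prod_Ico_succ_bot (by omega : m < n)]
        ring
    have e1 : 2 * n * (2 * n + 1) / 2 = n * (2 * n + 1) := by
      rw [mul_assoc, Nat.mul_div_cancel_left _ two_pos]
    have e2 : (2 * n + 1) * (2 * n + 1 + 1) / 2 = (2 * n + 1) * (n + 1) := by
      rw [show (2 * n + 1) * (2 * n + 1 + 1) = 2 * ((2 * n + 1) * (n + 1)) by ring,
        Nat.mul_div_cancel_left _ two_pos]
    rw [show 2 * (n + 1) = 2 * n + 1 + 1 by ring, Finset.sum_range_succ, Finset.sum_range_succ, e1, e2,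
      show 2 * n + 1 + 1 = 2 * (n + 1) by ring, Finset.sum_range_succ _ n, key _ le_rfl, ← ih,
      Finset.prod_range_succ _ n, Finset.prod_Ico_succ_top le_rfl, Finset.Ico_self,
      Finset.prod_empty]
    ring

end Finite

open Filter Topology PowerSeries in
theorem tendsto_X_pow_mul_zero {d : ℕ → ℕ} (hd : Tendsto d atTop atTop) (r : ℕ → ℤ⟦X⟧) :
    Tendsto (fun n => (X : ℤ⟦X⟧) ^ d n * r n) atTop (𝓝 0) := by
  rw [PowerSeries.WithPiTopology.tendsto_iff_coeff_tendsto]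
  intro k
  apply tendsto_nhds_of_eventually_eq
  filter_upwards [hd.eventually_gt_atTop k] with n hn
  rw [PowerSeries.coeff_X_pow_mul', if_neg (by omega), map_zero]

open Filter Topology PowerSeries in
theorem tendsto_prod_eulerF (k : ℕ) (hk : 1 ≤ k) :
    Tendsto (fun n => ∏ i ∈ Finset.range n, (1 - (X : ℤ⟦X⟧) ^ (k * (i + 1)))) atTop
      (𝓝 (eulerF k)) := by
  refine (eulerF_hasProd k hk).tendsto_prod_nat.congr fun n => Finset.prod_congr rfl fun i _ => ?_
  rw [← pow_mul, ← pow_add]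
  ring

/-- In the finite identity every term with s ≥ 1 is divisible by X^(n+1), so only s = 0 survives in
the limit. Multiplying by ∏ (1 - X^i) first turns ∏ (1 + X^i) into the product for f₂. -/
theorem eulerF_two_mul_of_hasSum {S : ℤ⟦X⟧}
    (hS : HasSum (fun s : ℕ => (-1) ^ s * (PowerSeries.X : ℤ⟦X⟧) ^ s ^ 2 +
      (-1) ^ (s + 1) * PowerSeries.X ^ (s + 1) ^ 2) S) :
    eulerF 2 * S = eulerF 1 ^ 2 := by
  have h1 : Filter.Tendsto (fun n => ∏ i ∈ Finset.range n, (1 - (PowerSeries.X : ℤ⟦X⟧) ^ (i + 1)))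
      Filter.atTop (nhds (eulerF 1)) := by simpa using tendsto_prod_eulerF 1 le_rfl
  have hl := (tendsto_prod_eulerF 2 one_le_two).mul
    (hS.tendsto_sum_nat.comp (Filter.tendsto_add_atTop_nat 1))
  have hr := h1.mul ((h1.comp (Filter.tendsto_add_atTop_nat 1)).add
    (tendsto_X_pow_mul_zero (Filter.tendsto_add_atTop_nat 1) fun n =>
      ∑ s ∈ Finset.range n, (-1) ^ (s + 1) * (∏ i ∈ Finset.range (s + 1),
        (1 + (PowerSeries.X : ℤ⟦X⟧) ^ (i + 1))) *
      (∏ i ∈ Finset.Ico (s + 1) (n + 1), (1 - PowerSeries.X ^ (i + 1))) *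
        PowerSeries.X ^ (s * (n + 1))))
  rw [add_zero, ← sq] at hr
  refine tendsto_nhds_unique (hl.congr fun n => ?_) hr
  have h := prod_one_add_mul_sum_sq (PowerSeries.X : ℤ⟦X⟧) n
  have h2 : ∏ i ∈ Finset.range n, (1 - (PowerSeries.X : ℤ⟦X⟧) ^ (2 * (i + 1))) =
      (∏ i ∈ Finset.range n, (1 - (PowerSeries.X : ℤ⟦X⟧) ^ (i + 1))) *
        ∏ i ∈ Finset.range n, (1 + (PowerSeries.X : ℤ⟦X⟧) ^ (i + 1)) := by
    rw [← Finset.prod_mul_distrib]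
    exact Finset.prod_congr rfl fun i _ => by ring
  simp only [Function.comp_apply]
  rw [h2, mul_assoc]
  congr 1
  rw [h, Finset.sum_range_succ' _ n, add_comm, Finset.mul_sum]
  congr 1
  · simp
  · exact Finset.sum_congr rfl fun s _ => by ring

theorem eulerF_one_mul_of_hasSum {S : ℤ⟦X⟧}
    (hS : HasSum (fun s : ℕ => (PowerSeries.X : ℤ⟦X⟧) ^ (s * (s + 1) / 2)) S) :
    eulerF 1 * S = eulerF 2 ^ 2 := by
  have h1 : Filter.Tendsto (fun n => ∏ i ∈ Finset.range n, (1 - (PowerSeries.X : ℤ⟦X⟧) ^ (i + 1)))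
      Filter.atTop (nhds (eulerF 1)) := by simpa using tendsto_prod_eulerF 1 le_rfl
  have h2 := tendsto_prod_eulerF 2 one_le_two
  have ht : Filter.Tendsto (fun n => 2 * (n + 1)) Filter.atTop Filter.atTop :=
    Filter.tendsto_atTop_mono (fun n => by simp only [id_eq]; omega) Filter.tendsto_id
  have hl := (h1.comp ht).mul (hS.tendsto_sum_nat.comp ht)
  have ht' : Filter.Tendsto (fun n => 2 * (n + 1) + 1) Filter.atTop Filter.atTop :=
    Filter.tendsto_atTop_mono (fun n => by simp only [id_eq]; omega) Filter.tendsto_id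
  have h2' := h2.comp (Filter.tendsto_add_atTop_nat 1)
  have hr := h2'.mul (h2'.add
    (tendsto_X_pow_mul_zero ht' fun n =>
      ∑ s ∈ Finset.range n, (∏ i ∈ Finset.range (s + 1),
        (1 - (PowerSeries.X : ℤ⟦X⟧) ^ (2 * i + 1))) *
      (∏ i ∈ Finset.Ico (s + 1) (n + 1), (1 - PowerSeries.X ^ (2 * (i + 1)))) *
        PowerSeries.X ^ (s * (2 * (n + 1) + 1))))
  rw [add_zero, ← sq] at hr
  refine tendsto_nhds_unique (hl.congr fun n => ?_) hr
  have h := prod_one_sub_odd_mul_sum_triangle (PowerSeries.X : ℤ⟦X⟧) (n + 1)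
  have h3 : ∀ n : ℕ, ∏ i ∈ Finset.range (2 * n), (1 - (PowerSeries.X : ℤ⟦X⟧) ^ (i + 1)) =
      (∏ i ∈ Finset.range n, (1 - (PowerSeries.X : ℤ⟦X⟧) ^ (2 * (i + 1)))) *
        ∏ i ∈ Finset.range n, (1 - (PowerSeries.X : ℤ⟦X⟧) ^ (2 * i + 1)) := by
    intro n
    induction n with
    | zero => simp
    | succ n ih =>
      rw [show 2 * (n + 1) = 2 * n + 1 + 1 by ring, Finset.prod_range_succ, Finset.prod_range_succ,
        ih, Finset.prod_range_succ _ n, Finset.prod_range_succ _ n]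
      ring
  simp only [Function.comp_apply]
  rw [h3, mul_assoc, h]
  congr 1
  rw [Finset.sum_range_succ' _ n, add_comm, Finset.mul_sum]
  congr 1
  · simp
  · exact Finset.sum_congr rfl fun s _ => by ring

/-! ### Quadratic relations and dissections of φ and ψ -/

theorem ofNat_ne_zero_powerSeries (k : ℕ) [k.AtLeastTwo] : (OfNat.ofNat k : ℤ⟦X⟧) ≠ 0 := fun h => by
  have := congrArg PowerSeries.constantCoeff h
  rw [map_ofNat, map_zero] at this
  exact OfNat.ofNat_ne_zero k this

/-- `ψ(q)^2 = φ(q) ψ(q^2)`. -/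
theorem psi_sq : psi ^ 2 = phi * PowerSeries.expand 2 two_ne_zero psi := by
  have h : (2 * psi) * (2 * psi) = phi * (2 * PowerSeries.expand 2 two_ne_zero psi) +
      phi * (2 * PowerSeries.expand 2 two_ne_zero psi) := by
    rw [two_mul_expand_psi, ← theta_triExp, phi, theta_mul finiteFibers_triExp finiteFibers_triExp,
      theta_mul finiteFibers_sqExp (finiteFibers_triExp.mul_left two_ne_zero)]
    -- For i+j even, i = u+v and j = u-v give exponent v² + u(u+1). The odd class reduces to the
    -- same sum by i ↦ -1-i, which fixes the triangular exponent.
    refine theta_split (finiteFibers_triExp.add finiteFibers_triExp)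
      (fun p => (p.1 + p.2) % 2 = 0) (g := fun p => (p.2 + p.1, p.2 - p.1))
      (g' := fun p => (-1 - (p.2 + p.1), p.2 - p.1)) ?_ ?_ ?_ ?_ ?_ ?_ ?_ ?_
    · rintro ⟨a, b⟩ ⟨c, d⟩ h; simp only [Prod.mk.injEq] at h ⊢; omega
    · rintro ⟨a, b⟩ ⟨c, d⟩ h; simp only [Prod.mk.injEq] at h ⊢; omega
    · rintro ⟨i, j⟩
      refine ⟨fun h => ⟨((i - j) / 2, (i + j) / 2), ?_⟩, ?_⟩
      · simp only [Prod.mk.injEq] at h ⊢; omega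
      · rintro ⟨⟨u, v⟩, h⟩; simp only [Prod.mk.injEq] at h ⊢; omega
    · rintro ⟨i, j⟩
      refine ⟨fun h => ⟨(-(i + j + 1) / 2, j - (i + j + 1) / 2), ?_⟩, ?_⟩
      · simp only [Prod.mk.injEq] at h ⊢; omega
      · rintro ⟨⟨u, v⟩, h⟩; simp only [Prod.mk.injEq] at h ⊢; omega
    · simp
    · simp
    · rintro ⟨v, u⟩
      have h1 := two_mul_triExp (u + v)
      have h2 := two_mul_triExp (u - v)
      have h3 := two_mul_triExp u
      zify
      simp only [natCast_sqExp]
      linarith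
    · rintro ⟨v, u⟩
      have h1 := two_mul_triExp (-1 - (u + v))
      have h2 := two_mul_triExp (u - v)
      have h3 := two_mul_triExp u
      zify
      simp only [natCast_sqExp]
      linarith
  have h4 : (4 : ℤ⟦X⟧) ≠ 0 := ofNat_ne_zero_powerSeries 4
  apply mul_left_cancel₀ h4
  linear_combination h

/-- `φ(q)^2 = φ(q^2)^2 + 4 q ψ(q^4)^2`. -/
theorem phi_sq : phi ^ 2 = PowerSeries.expand 2 two_ne_zero phi ^ 2 +
    4 * PowerSeries.X * PowerSeries.expand 4 four_ne_zero psi ^ 2 := by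
  have h : phi * phi = PowerSeries.expand 2 two_ne_zero phi * PowerSeries.expand 2 two_ne_zero phi +
      PowerSeries.X ^ 1 * ((2 * PowerSeries.expand 4 four_ne_zero psi) *
        (2 * PowerSeries.expand 4 four_ne_zero psi)) := by
    have f2 := finiteFibers_sqExp.mul_left two_ne_zero
    have f4 := finiteFibers_triExp.mul_left four_ne_zero
    rw [two_mul_expand_psi, expand_phi, phi, theta_mul finiteFibers_sqExp finiteFibers_sqExp,
      theta_mul f2 f2, theta_mul f4 f4, X_pow_mul_theta (f4.add f4)]
    -- In the odd class, (u+v+1)² + (u-v)² = 1 + 2u(u+1) + 2v(v+1).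
    refine theta_split (finiteFibers_sqExp.add finiteFibers_sqExp)
      (fun p => (p.1 + p.2) % 2 = 0) (g := fun p => (p.1 + p.2, p.1 - p.2))
      (g' := fun p => (p.1 + p.2 + 1, p.1 - p.2)) ?_ ?_ ?_ ?_ ?_ ?_ ?_ ?_
    · rintro ⟨a, b⟩ ⟨c, d⟩ h; simp only [Prod.mk.injEq] at h ⊢; omega
    · rintro ⟨a, b⟩ ⟨c, d⟩ h; simp only [Prod.mk.injEq] at h ⊢; omega
    · rintro ⟨i, j⟩
      refine ⟨fun h => ⟨((i + j) / 2, (i - j) / 2), ?_⟩, ?_⟩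
      · simp only [Prod.mk.injEq] at h ⊢; omega
      · rintro ⟨⟨u, v⟩, h⟩; simp only [Prod.mk.injEq] at h ⊢; omega
    · rintro ⟨i, j⟩
      refine ⟨fun h => ⟨((i + j - 1) / 2, (i - j - 1) / 2), ?_⟩, ?_⟩
      · simp only [Prod.mk.injEq] at h ⊢; omega
      · rintro ⟨⟨u, v⟩, h⟩; simp only [Prod.mk.injEq] at h ⊢; omega
    · simp
    · simp
    · rintro ⟨u, v⟩
      zify
      simp only [natCast_sqExp]
      ring
    · rintro ⟨u, v⟩
      have h1 := two_mul_triExp u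
      have h2 := two_mul_triExp v
      zify
      simp only [natCast_sqExp]
      linarith
  linear_combination h

/-- `φ(-q) = φ(q^4) - 2 q ψ(q^8)`. -/
theorem phiNeg_eq : phiNeg = PowerSeries.expand 4 four_ne_zero phi -
    2 * PowerSeries.X * PowerSeries.expand 8 (by norm_num) psi := by
  have h : phiNeg = PowerSeries.expand 4 four_ne_zero phi +
      -(PowerSeries.X ^ 1 * (2 * PowerSeries.expand 8 (by norm_num) psi)) := by
    rw [two_mul_expand_psi, expand_phi, phiNeg,
      X_pow_mul_theta (finiteFibers_triExp.mul_left (by norm_num)), ← theta_neg]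
    refine theta_split finiteFibers_sqExp
      (fun p => p % 2 = 0) (g := fun p => 2 * p) (g' := fun p => 2 * p + 1) ?_ ?_ ?_ ?_ ?_ ?_ ?_ ?_
    · intro a b h; dsimp only at h; omega
    · intro a b h; dsimp only at h; omega
    · exact fun i => ⟨fun h => ⟨i / 2, by omega⟩, by rintro ⟨k, rfl⟩; omega⟩
    · exact fun i => ⟨fun h => ⟨i / 2, by omega⟩, by rintro ⟨k, rfl⟩; omega⟩
    · intro k; rw [Int.negOnePow_even _ (even_two_mul k)]; simp
    · intro k; rw [Int.negOnePow_odd _ (odd_two_mul_add_one k)]; simp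
    · intro u
      zify
      simp only [natCast_sqExp]
      ring
    · intro u
      have h1 := two_mul_triExp u
      zify
      simp only [natCast_sqExp]
      linarith
  linear_combination h

/-! ### The form a² + 5b² and the product f₁f₅ -/

section Quadratic

/-- The exponent `(a^2 + 5 b^2 - 1) / 4`. -/
def quadExp (p : ℤ × ℤ) : ℕ := ((p.1 ^ 2 + 5 * p.2 ^ 2 - 1) / 4).toNat

theorem quadExp_eq {p : ℤ × ℤ} {n : ℕ} (h : p.1 ^ 2 + 5 * p.2 ^ 2 = 4 * n + 1) :
    quadExp p = n := by
  unfold quadExp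
  rw [h]
  omega

theorem finiteFibers_quadExp : FiniteFibers quadExp := fun n =>
  ((Set.finite_Icc (-(4 * n + 5) : ℤ) (4 * n + 5)).prod
    (Set.finite_Icc (-(4 * n + 5) : ℤ) (4 * n + 5))).subset fun p hp => by
      have h : p.1 ^ 2 + 5 * p.2 ^ 2 ≤ 4 * n + 5 := by
        have : quadExp p = n := hp
        rw [quadExp] at this
        generalize p.1 ^ 2 + 5 * p.2 ^ 2 = x at this ⊢
        omega
      simp only [Set.mem_prod, Set.mem_Icc]
      refine ⟨⟨?_, ?_⟩, ?_, ?_⟩ <;>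
        nlinarith [sq_nonneg p.1, sq_nonneg p.2, sq_nonneg (p.1 - 1), sq_nonneg (p.1 + 1),
          sq_nonneg (p.2 - 1), sq_nonneg (p.2 + 1)]

/-- The sign `(-1)^b` on pairs of opposite parity with `a + b ≡ r (mod 3)`. -/
def quadSign (r : ℤ) (p : ℤ × ℤ) : ℤ :=
  if (p.1 + p.2) % 2 = 1 ∧ (p.1 + p.2) % 3 = r then if p.2 % 2 = 0 then 1 else -1 else 0

theorem negOnePow_eq_ite (j : ℤ) : (Int.negOnePow j : ℤ) = if j % 2 = 0 then 1 else -1 := by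
  split_ifs with h
  · rw [Int.negOnePow_even _ (Int.even_iff.2 h)]; simp
  · rw [Int.negOnePow_odd _ (Int.odd_iff.2 (by omega))]; simp

/-- With a = 3m - b the form becomes 9m² - 6mb + 6b², invariant under b ↦ m - b. As a + b = 3m is
odd, so is m; the involution therefore flips the sign (-1)^b and the sum equals its own negative. -/
theorem theta_quadSign_zero : theta (quadSign 0) quadExp = 0 := by
  have h1 : theta (quadSign 0) quadExp =
      theta (fun p : ℤ × ℤ => quadSign 0 (3 * p.1 - p.2, p.2))
        (fun p => quadExp (3 * p.1 - p.2, p.2)) := by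
    refine theta_eq_of_injective (g := fun p => (3 * p.1 - p.2, p.2)) ?_ ?_
      (fun _ => rfl) fun _ => rfl
    · rintro ⟨a, b⟩ ⟨c, d⟩ h; simp only [Prod.mk.injEq] at h ⊢; omega
    · rintro ⟨a, b⟩ h
      refine ⟨((a + b) / 3, b), ?_⟩
      simp only [quadSign, ne_eq, ite_eq_right_iff, not_forall] at h
      obtain ⟨h, -⟩ := h
      simp only [Prod.mk.injEq, and_true] at h ⊢; omega
  have h2 : theta (fun p : ℤ × ℤ => quadSign 0 (3 * p.1 - p.2, p.2))
        (fun p => quadExp (3 * p.1 - p.2, p.2)) =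
      theta (fun p : ℤ × ℤ => -quadSign 0 (3 * p.1 - p.2, p.2))
        (fun p => quadExp (3 * p.1 - p.2, p.2)) := by
    refine theta_eq_of_injective (g := fun p => (p.1, p.1 - p.2)) ?_ ?_ ?_ ?_
    · rintro ⟨a, b⟩ ⟨c, d⟩ h; simp only [Prod.mk.injEq] at h ⊢; omega
    · rintro ⟨a, b⟩ -
      exact ⟨(a, a - b), by simp⟩
    · rintro ⟨a, b⟩
      simp only [quadSign]
      split_ifs <;> first | rfl | omega
    · rintro ⟨a, b⟩
      simp only [quadExp]
      congr 2
      ring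
  rw [theta_neg, ← h1] at h2
  have h3 : (2 : ℤ⟦X⟧) * theta (quadSign 0) quadExp = 0 := by linear_combination h2
  exact (mul_eq_zero.1 h3).resolve_left (ofNat_ne_zero_powerSeries 2)

theorem eulerF_five_eq_theta :
    eulerF 5 = theta (fun j => (Int.negOnePow j : ℤ)) (fun j => 5 * pentagonal j) := by
  rw [← expand_theta finiteFibers_pentagonal 5 (by norm_num), ← eulerF_one_eq_theta,
    expand_eulerF 5 (by norm_num) 1 one_ne_zero]

/-- By the pentagonal number theorem f₁f₅ is a sum over (m, n). Completing squares and rotating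
gives a = ε(m+5n-1), b = ε(n-m); then a + b = ε(6n-1) covers exactly one odd nonzero class modulo 3.
-/
theorem theta_quadSign_of_unit {r ε : ℤ} (h : r = 2 ∧ ε = 1 ∨ r = 1 ∧ ε = -1) :
    theta (quadSign r) quadExp = eulerF 1 * eulerF 5 := by
  rw [eulerF_one_eq_theta, eulerF_five_eq_theta,
    theta_mul finiteFibers_pentagonal (finiteFibers_pentagonal.mul_left (by norm_num))]
  refine theta_eq_of_injective
    (g := fun p => (ε * (p.1 + 5 * p.2 - 1), ε * (p.2 - p.1))) ?_ ?_ ?_ ?_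
  · rintro ⟨a, b⟩ ⟨c, d⟩ hs
    rcases h with ⟨rfl, rfl⟩ | ⟨rfl, rfl⟩ <;> simp only [Prod.mk.injEq] at hs ⊢ <;> omega
  · rintro ⟨a, b⟩ hs
    simp only [quadSign, ne_eq, ite_eq_right_iff, not_forall] at hs
    obtain ⟨hs, -⟩ := hs
    refine ⟨((ε * (a + b) + 1) / 6 - ε * b, (ε * (a + b) + 1) / 6), ?_⟩
    rcases h with ⟨rfl, rfl⟩ | ⟨rfl, rfl⟩ <;> simp only [Prod.mk.injEq] at hs ⊢ <;> omega
  · rintro ⟨m, n⟩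
    simp only [quadSign, negOnePow_eq_ite]
    rcases h with ⟨rfl, rfl⟩ | ⟨rfl, rfl⟩ <;> split_ifs <;> first | rfl | omega
  · rintro ⟨m, n⟩
    apply quadExp_eq
    have h1 := two_mul_natCast_pentagonal m
    have h2 := two_mul_natCast_pentagonal n
    have h3 : ε * ε = 1 := by rcases h with ⟨-, rfl⟩ | ⟨-, rfl⟩ <;> rfl
    push_cast
    linear_combination ((m + 5 * n - 1) ^ 2 + 5 * (n - m) ^ 2) * h3 - 2 * h1 - 10 * h2

/-- `f₁ f₅ = ψ(q^2) φ(q^5) - q φ(q) ψ(q^10)`. -/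
theorem eulerF_one_mul_eulerF_five : eulerF 1 * eulerF 5 =
    PowerSeries.expand 2 two_ne_zero psi * PowerSeries.expand 5 (by norm_num) phi -
      PowerSeries.X * phi * PowerSeries.expand 10 (by norm_num) psi := by
  have f2 := finiteFibers_triExp.mul_left two_ne_zero
  have f10 := finiteFibers_triExp.mul_left (by norm_num : 10 ≠ 0)
  have f5 := finiteFibers_sqExp.mul_left (by norm_num : 5 ≠ 0)
  have h1 : (2 * PowerSeries.expand 2 two_ne_zero psi) *
      PowerSeries.expand 5 (by norm_num) phi =
      theta (fun p : ℤ × ℤ => if p.1 % 2 = 1 ∧ p.2 % 2 = 0 then 1 else 0) quadExp := by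
    rw [two_mul_expand_psi, expand_phi, theta_mul f2 f5]
    symm
    refine theta_eq_of_injective (g := fun p => (2 * p.1 + 1, 2 * p.2)) ?_ ?_ ?_ ?_
    · rintro ⟨a, b⟩ ⟨c, d⟩ h; simp only [Prod.mk.injEq] at h ⊢; omega
    · rintro ⟨a, b⟩ h
      refine ⟨(a / 2, b / 2), ?_⟩
      simp only [ne_eq, ite_eq_right_iff, not_forall] at h
      obtain ⟨h, -⟩ := h
      simp only [Prod.mk.injEq]; omega
    · rintro ⟨a, b⟩
      rw [if_pos (by omega)]; rfl
    · rintro ⟨a, b⟩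
      apply quadExp_eq
      have h1 := two_mul_triExp a
      push_cast
      rw [natCast_sqExp]
      linear_combination -4 * h1
  have h2 : PowerSeries.X ^ 1 * (phi * (2 * PowerSeries.expand 10 (by norm_num) psi)) =
      theta (fun p : ℤ × ℤ => if p.1 % 2 = 0 ∧ p.2 % 2 = 1 then 1 else 0) quadExp := by
    rw [two_mul_expand_psi, phi, theta_mul finiteFibers_sqExp f10,
      X_pow_mul_theta (finiteFibers_sqExp.add f10)]
    symm
    refine theta_eq_of_injective (g := fun p => (2 * p.1, 2 * p.2 + 1)) ?_ ?_ ?_ ?_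
    · rintro ⟨a, b⟩ ⟨c, d⟩ h; simp only [Prod.mk.injEq] at h ⊢; omega
    · rintro ⟨a, b⟩ h
      refine ⟨(a / 2, b / 2), ?_⟩
      simp only [ne_eq, ite_eq_right_iff, not_forall] at h
      obtain ⟨h, -⟩ := h
      simp only [Prod.mk.injEq]; omega
    · rintro ⟨a, b⟩
      rw [if_pos (by omega)]; rfl
    · rintro ⟨a, b⟩
      apply quadExp_eq
      have h1 := two_mul_triExp b
      push_cast
      rw [natCast_sqExp]
      linear_combination -20 * h1
  -- Twice the right-hand side is the sum of (-1)^b over pairs of opposite parity. Split by a + b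
  -- modulo 3, class 0 vanishes and the other two each give f₁f₅.
  have h3 : theta (fun p : ℤ × ℤ => if p.1 % 2 = 1 ∧ p.2 % 2 = 0 then 1 else 0) quadExp -
      theta (fun p : ℤ × ℤ => if p.1 % 2 = 0 ∧ p.2 % 2 = 1 then 1 else 0) quadExp =
      theta (quadSign 0) quadExp + (theta (quadSign 1) quadExp + theta (quadSign 2) quadExp) := by
    rw [← theta_sub finiteFibers_quadExp, ← theta_add finiteFibers_quadExp,
      ← theta_add finiteFibers_quadExp]
    congr 1
    funext ⟨a, b⟩
    simp only [quadSign]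
    split_ifs <;> first | rfl | omega
  rw [← h1, ← h2, theta_quadSign_zero, theta_quadSign_of_unit (Or.inl ⟨rfl, rfl⟩),
    theta_quadSign_of_unit (Or.inr ⟨rfl, rfl⟩)] at h3
  apply mul_left_cancel₀ (ofNat_ne_zero_powerSeries 2)
  linear_combination -h3

end Quadratic

/-! ### The 2-dissection of f₁⁴f₅⁴ and the recurrence -/

section Dissection

open PowerSeries (expand X)

theorem expand_expand_eq {a b c : ℕ} (h : a * b = c) (ha : a ≠ 0) (hb : b ≠ 0) (hc : c ≠ 0)
    (f : ℤ⟦X⟧) : expand a ha (expand b hb f) = expand c hc f := by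
  subst h
  exact (PowerSeries.expand_mul a ha b hb f).symm

/-- Regrouping the expanded product and applying the relations for φ² and ψ² gives ψ(q²)²φ(q⁵)² +
q²φ(q)²ψ(q¹⁰)². This is the square of ψ(q²)φ(q⁵) - qφ(q)ψ(q¹⁰) = f₁f₅ plus a cross term, which is
2qψ(q)²ψ(q⁵)². -/
theorem theta_product_identity :
    (expand 2 two_ne_zero phi * expand 10 (by norm_num) phi +
        4 * X ^ 3 * expand 4 four_ne_zero psi * expand 20 (by norm_num) psi) *
      (expand 4 four_ne_zero psi * expand 10 (by norm_num) phi +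
        X ^ 2 * expand 2 two_ne_zero phi * expand 20 (by norm_num) psi) =
    eulerF 1 ^ 2 * eulerF 5 ^ 2 + 2 * X * psi ^ 2 * expand 5 (by norm_num) psi ^ 2 := by
  have h1 := congrArg (expand 2 two_ne_zero) psi_sq
  have h2 := congrArg (expand 10 (by norm_num)) psi_sq
  have h3 := congrArg (expand 5 (by norm_num)) psi_sq
  have h4 := congrArg (expand 5 (by norm_num)) phi_sq
  simp only [map_mul, map_add, map_pow, map_ofNat, PowerSeries.expand_X] at h1 h2 h3 h4
  rw [expand_expand_eq (by norm_num : 2 * 2 = 4) _ _ four_ne_zero] at h1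
  rw [expand_expand_eq (by norm_num : 10 * 2 = 20) _ _ (by norm_num)] at h2
  rw [expand_expand_eq (by norm_num : 5 * 2 = 10) _ _ (by norm_num)] at h3
  rw [expand_expand_eq (by norm_num : 5 * 2 = 10) _ _ (by norm_num),
    expand_expand_eq (by norm_num : 5 * 4 = 20) _ _ (by norm_num)] at h4
  have h5 := psi_sq
  have h6 := phi_sq
  have h7 := eulerF_one_mul_eulerF_five
  set F2 := expand 2 two_ne_zero phi
  set S2 := expand 2 two_ne_zero psi
  set S4 := expand 4 four_ne_zero psi
  set F10 := expand 10 (by norm_num) phi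
  set S10 := expand 10 (by norm_num) psi
  set S20 := expand 20 (by norm_num) psi
  set F5 := expand 5 (by norm_num) phi
  set S5 := expand 5 (by norm_num) psi
  linear_combination -F2 * S4 * h4 - X ^ 2 * F10 * S20 * h6 - F5 ^ 2 * h1 - X ^ 2 * phi ^ 2 * h2
    - (eulerF 1 * eulerF 5 + S2 * F5 - X * phi * S10) * h7
    - 2 * X * (F5 * S10 * h5 + psi ^ 2 * h3)

theorem eulerF_two_mul_phiNeg : eulerF 2 * phiNeg = eulerF 1 ^ 2 :=
  eulerF_two_mul_of_hasSum hasSum_phiNeg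

theorem eulerF_one_mul_psi : eulerF 1 * psi = eulerF 2 ^ 2 :=
  eulerF_one_mul_of_hasSum hasSum_psi

/-- The generating function splits into even and odd parts, the odd part being a combination of
the generating function itself and its dilation by two. -/
theorem exists_dissection : ∃ A : ℤ⟦X⟧, eulerF 1 ^ 4 * eulerF 5 ^ 4 =
    expand 2 two_ne_zero A + X * expand 2 two_ne_zero (-4 * (eulerF 1 ^ 4 * eulerF 5 ^ 4) -
      8 * (X * expand 2 two_ne_zero (eulerF 1 ^ 4 * eulerF 5 ^ 4))) := by
  have g1 := eulerF_two_mul_phiNeg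
  rw [phiNeg_eq] at g1
  have g2 := congrArg (expand 5 (by norm_num)) g1
  have g3 := eulerF_one_mul_psi
  have g4 := congrArg (expand 5 (by norm_num)) g3
  have hQ := theta_product_identity
  simp only [map_mul, map_sub, map_pow, map_ofNat, PowerSeries.expand_X] at g2 g4
  rw [expand_expand_eq (by norm_num : 5 * 4 = 20) _ _ (by norm_num),
    expand_expand_eq (by norm_num : 5 * 8 = 40) _ _ (by norm_num),
    expand_eulerF _ _ _ two_ne_zero, expand_eulerF _ _ _ one_ne_zero] at g2
  rw [expand_eulerF _ _ _ two_ne_zero, expand_eulerF _ _ _ one_ne_zero] at g4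
  norm_num only at g2 g4
  -- Write φ(-q)φ(-q⁵) = E(q²) - 2qO(q²). Its square has even part E(q²)² + 4q²O(q²)² and odd part
  -- -4qE(q²)O(q²); the witness is f₁²f₅²(E² + 4qO²).
  refine ⟨eulerF 1 ^ 2 * eulerF 5 ^ 2 *
    ((expand 2 two_ne_zero phi * expand 10 (by norm_num) phi +
        4 * X ^ 3 * expand 4 four_ne_zero psi * expand 20 (by norm_num) psi) ^ 2 + 4 * X *
      (expand 4 four_ne_zero psi * expand 10 (by norm_num) phi +
        X ^ 2 * expand 2 two_ne_zero phi * expand 20 (by norm_num) psi) ^ 2), ?_⟩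
  have hB : -4 * (eulerF 1 ^ 4 * eulerF 5 ^ 4) -
      8 * (X * expand 2 two_ne_zero (eulerF 1 ^ 4 * eulerF 5 ^ 4)) =
      -4 * (eulerF 1 ^ 2 * eulerF 5 ^ 2) * (eulerF 1 ^ 2 * eulerF 5 ^ 2 +
        2 * X * psi ^ 2 * expand 5 (by norm_num) psi ^ 2) := by
    have : expand 2 two_ne_zero (eulerF 1 ^ 4 * eulerF 5 ^ 4) =
        (eulerF 1 * psi) ^ 2 * (eulerF 5 * expand 5 (by norm_num) psi) ^ 2 := by
      rw [g3, g4, map_mul, map_pow, map_pow, expand_eulerF _ _ _ one_ne_zero,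
        expand_eulerF _ _ _ (by norm_num)]
      norm_num only
      ring
    rw [this]
    ring
  rw [hB, ← hQ]
  simp only [map_mul, map_add, map_neg, map_pow, map_ofNat, PowerSeries.expand_X]
  rw [expand_expand_eq (by norm_num : 2 * 2 = 4) _ _ four_ne_zero,
    expand_expand_eq (by norm_num : 2 * 4 = 8) _ _ (by norm_num),
    expand_expand_eq (by norm_num : 2 * 10 = 20) _ _ (by norm_num),
    expand_expand_eq (by norm_num : 2 * 20 = 40) _ _ (by norm_num),
    expand_eulerF _ _ _ one_ne_zero, expand_eulerF _ _ _ (by norm_num)]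
  norm_num only
  rw [show eulerF 1 ^ 4 * eulerF 5 ^ 4 = (eulerF 1 ^ 2) ^ 2 * (eulerF 5 ^ 2) ^ 2 by ring,
    ← g1, ← g2]
  ring

theorem coeff_odd_of_dissection {G A B : ℤ⟦X⟧}
    (h : G = expand 2 two_ne_zero A + X * expand 2 two_ne_zero B) (n : ℕ) :
    PowerSeries.coeff (2 * n + 1) G = PowerSeries.coeff n B := by
  rw [h, map_add, PowerSeries.coeff_expand_of_not_dvd _ _ _ (by omega),
    PowerSeries.coeff_succ_X_mul, PowerSeries.coeff_expand_mul, zero_add]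

/-- The action of the Hecke operator at two, at odd arguments. -/
theorem Pstar_four_mul_add_three (n : ℕ) :
    Pstar (4 * n + 3) = -4 * Pstar (2 * n + 1) - 8 * Pstar n := by
  obtain ⟨A, h⟩ := exists_dissection
  have h1 := coeff_odd_of_dissection h (2 * n + 1)
  rw [show (-4 : ℤ⟦X⟧) = PowerSeries.C (-4) by simp, show (8 : ℤ⟦X⟧) = PowerSeries.C 8 by simp,
    map_sub, PowerSeries.coeff_C_mul, PowerSeries.coeff_C_mul, PowerSeries.coeff_succ_X_mul,
    PowerSeries.coeff_expand_mul] at h1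
  rw [Pstar, Pstar, Pstar, ← h1]
  congr 2
  ring

end Dissection

theorem theorem1p2 (n : ℕ) : Pstar (16 * n + 15) = -64 * Pstar n := by
  -- The combination `h3` - 4 `h2` + 8 `h1` eliminates the intermediate values, reflecting x⁴ + 64 =
  -- (x² + 4x + 8)(x² - 4x + 8).
  have h1 := Pstar_four_mul_add_three n
  have h2 := Pstar_four_mul_add_three (2 * n + 1)
  have h3 := Pstar_four_mul_add_three (4 * n + 3)
  ring_nf at h1 h2 h3 ⊢
  linarith
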